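/- Let $R$ be a commutative Noetherian ring with nonzero identity, $\mathfrak a$ an ideal of $R$ and $N$ an Artinian $R$-module. Write $(0:_N\mathfrak b)=\{y\in N:\mathfrak b y=0\}$ for an ideal $\mathfrak b$ of $R$, and $\operatorname{Cosupp}_R(K)$ for the set of prime ideals of $R$ containing $\operatorname{Ann}_R(K)$. A sequence $x_1,\dots,x_n$ ($n\ge 0$) of elements of $\mathfrak a$ is called a filter coregular $N$-sequence in $\mathfrak a$ of length $n$ if, for all $1\le i\le n$, every prime ideal in $$\operatorname{Cosupp}_R\big((0:_N(x_1,\dots,x_{i-1})R)\,/\,x_i(0:_N(x_1,\dots,x_{i-1})R)\big)$$ is maximal; an infinite sequence is one if all of its finite initial segments are. Let $\operatorname{f-width}_{\mathfrak a}(N)=\infty$ if there is a filter coregular $N$-sequence in $\mathfrak a$ of infinite length, and otherwise let $\operatorname{f-width}_{\mathfrak a}(N)$ be the common length of all maximal filter coregular $N$-sequences in $\mathfrak a$. If $\operatorname{f-width}_{\mathfrak a}(N)=\infty$, then $(0:_N\mathfrak a)$ has finite length. Conversely, if $R$ is semi-local (has only finitely many maximal ideals) and complete with respect to its Jacobson radical,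 and $(0:_N\mathfrak a)$ has finite length, then $\operatorname{f-width}_{\mathfrak a}(N)=\infty$. -/

import Mathlib

namespace FilterCoregular

universe u v

section Defs

variable (R : Type u) [CommRing R] (N : Type v) [AddCommGroup N] [Module R N]

/-- `Max(R)`, as a subset of the prime spectrum. -/
def maxSet : Set (PrimeSpectrum R) :=
  {p | p.asIdeal.IsMaximal}

/-- `Cosupp_R(N)`: the primes containing the annihilator of `N`. -/
def cosupp : Set (PrimeSpectrum R) :=
  {p | Module.annihilator R N ≤ p.asIdeal}

variable {R}

/-- `(0 :_N 𝔞)`, the submodule of those `y` in `N` with `a • y = 0` for all `a ∈ 𝔞`. -/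
abbrev zeroColon (𝔞 : Ideal R) : Submodule R N :=
  Submodule.torsionBySet R N (𝔞 : Set R)

/-- `x 0, …, x (n - 1)` is a filter coregular `N`-sequence: for all `i`, with `K` the submodule
`(0 :_N (x 0, …, x (i - 1)) R)` of `N`, every prime in `Cosupp_R(K / x i • K)` is maximal.
The empty sequence (`n = 0`) is one. -/
def IsFilterCoregular {n : ℕ} (x : Fin n → R) : Prop :=
  ∀ i : Fin n,
    cosupp R (QuotSMulTop (x i) (zeroColon N (Ideal.span (x '' {j | j < i})))) ⊆ maxSet R

/-- A filter coregular `N`-sequence in `𝔞`. -/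
def IsFilterCoregularIn (𝔞 : Ideal R) {n : ℕ} (x : Fin n → R) : Prop :=
  (∀ i, x i ∈ 𝔞) ∧ IsFilterCoregular N x

/-- A filter coregular `N`-sequence in `𝔞` of infinite length: all its finite initial segments
are filter coregular `N`-sequences in `𝔞`. -/
def IsInfiniteFilterCoregularIn (𝔞 : Ideal R) (x : ℕ → R) : Prop :=
  ∀ n : ℕ, IsFilterCoregularIn N 𝔞 (fun i : Fin n => x i)

/-- A (finite) maximal filter coregular `N`-sequence in `𝔞`: it cannot be extended by one more
element. -/
def IsMaximalFilterCoregularIn (𝔞 : Ideal R) {n : ℕ} (x : Fin n → R) : Prop :=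
  IsFilterCoregularIn N 𝔞 x ∧
    ∀ y : R, ¬ IsFilterCoregularIn N 𝔞 (Fin.snoc x y : Fin (n + 1) → R)

open Classical in
/-- `f-width_𝔞(N)`: it is `∞` if there is a filter coregular `N`-sequence in `𝔞` of infinite
length, and otherwise the common length of the maximal filter coregular `N`-sequences in `𝔞`.
In the second case maximal sequences exist (`exists_isMaximalFilterCoregularIn` below); for
`R` Noetherian and `N` Artinian they all have the same length, so that the least of their
lengths, which is what is taken here, is that common length. -/
noncomputable def fWidth (𝔞 : Ideal R) : ℕ∞ :=
  if ∃ x : ℕ → R, IsInfiniteFilterCoregularIn N 𝔞 x then ⊤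
  else ((sInf {n : ℕ | ∃ x : Fin n → R, IsMaximalFilterCoregularIn N 𝔞 x} : ℕ) : ℕ∞)

theorem fWidth_eq_top_iff (𝔞 : Ideal R) :
    fWidth N 𝔞 = ⊤ ↔ ∃ x : ℕ → R, IsInfiniteFilterCoregularIn N 𝔞 x := by
  unfold fWidth
  split_ifs with h <;> simp [h]

theorem exists_isMaximalFilterCoregularIn (𝔞 : Ideal R)
    (h : ¬ ∃ x : ℕ → R, IsInfiniteFilterCoregularIn N 𝔞 x) :
    ∃ (n : ℕ) (x : Fin n → R), IsMaximalFilterCoregularIn N 𝔞 x := by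
  by_contra! H
  apply h
  have step : ∀ (n : ℕ) (x : {x : Fin n → R // IsFilterCoregularIn N 𝔞 x}),
      ∃ y : R, IsFilterCoregularIn N 𝔞 (Fin.snoc x.1 y : Fin (n + 1) → R) := by
    intro n x
    by_contra! hx
    exact H n x.1 ⟨x.2, hx⟩
  choose next hnext using step
  let s : (n : ℕ) → {x : Fin n → R // IsFilterCoregularIn N 𝔞 x} := fun n =>
    Nat.rec ⟨Fin.elim0, fun i => i.elim0, fun i => i.elim0⟩
      (fun n x => ⟨Fin.snoc x.1 (next n x), hnext n x⟩) n
  have hs : ∀ n, (fun i : Fin n => next i (s i)) = (s n).1 := by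
    intro n
    induction n with
    | zero => exact funext fun i => i.elim0
    | succ n ih =>
      have e : (s (n + 1)).1 = Fin.snoc (s n).1 (next n (s n)) := rfl
      rw [e, ← ih]
      funext i
      refine Fin.lastCases ?_ (fun j => ?_) i <;> simp
  refine ⟨fun n => next n (s n), fun n => ?_⟩
  rw [hs n]
  exact (s n).2

end Defs

end FilterCoregular

open FilterCoregular
open scoped Pointwise

section ZeroColon

variable {R : Type*} [CommRing R] {M : Type*} [AddCommGroup M] [Module R M]

/-! If an infinite sequence exists, the submodules K_n = (0 :_N (x_0, …, x_{n-1})) descend and so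
stabilise. Where K_n = K_{n+1}, x_n kills K_n, so K_n is its own quotient by x_n and its cosupport
consists of maximal ideals. Thus K_n has finite length, and it contains (0 :_N 𝔞).

For the converse it suffices to extend every finite sequence by one element. With K the current
annihilator submodule, dualise into an injective cogenerator E, writing D = Hom(-, E). Completeness
makes D(K) finitely generated (`finite_dual_of_isArtinian`). A power of the Jacobson radical kills
(0 :_K 𝔞), hence D(K)/𝔞D(K), so the associated primes of D(K) containing 𝔞 are maximal. Prime
avoidance yields y ∈ 𝔞 outside all nonmaximal associated primes; as D(K/yK) = (0 :_{D(K)} y), this y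
extends the sequence (`exists_mem_cosupp_quotSMulTop_subset`). -/

theorem mem_zeroColon_iff {𝔟 : Ideal R} {x : M} : x ∈ zeroColon M 𝔟 ↔ ∀ r ∈ 𝔟, r • x = 0 :=
  (Submodule.mem_torsionBySet_iff _ _).trans Subtype.forall

end ZeroColon

/-! ### Powers of the Jacobson radical on Artinian modules -/

section Nakayama

variable {R : Type*} [CommRing R] {M : Type*} [AddCommGroup M] [Module R M]

theorem exists_jacobson_pow_smul_top_eq_bot [IsArtinian R M] [IsNoetherian R M] :
    ∃ s : ℕ, Ring.jacobson R ^ s • (⊤ : Submodule R M) = ⊥ := by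
  obtain ⟨n, hn⟩ := IsArtinian.monotone_stabilizes (R := R) (M := M)
    ⟨fun n => OrderDual.toDual (Ring.jacobson R ^ n • (⊤ : Submodule R M)),
      fun a b h => Submodule.smul_mono_left (Ideal.pow_le_pow_right h)⟩
  refine ⟨n, Submodule.eq_bot_of_le_smul_of_le_jacobson_bot (Ring.jacobson R) _
    (IsNoetherian.noetherian _) ?_ (Ideal.jacobson_bot).ge⟩
  have h : Ring.jacobson R ^ n • (⊤ : Submodule R M) = Ring.jacobson R ^ (n + 1) • ⊤ :=
    hn (n + 1) (Nat.le_succ n)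
  rw [← mul_smul, ← pow_succ', ← h]

theorem exists_jacobson_pow_smul_eq_zero [IsNoetherianRing R] [IsArtinian R M] (x : M) :
    ∃ s : ℕ, ∀ r ∈ Ring.jacobson R ^ s, r • x = 0 := by
  obtain ⟨s, hs⟩ := exists_jacobson_pow_smul_top_eq_bot (R := R) (M := Submodule.span R {x})
  refine ⟨s, fun r hr => ?_⟩
  have h : r • (⟨x, Submodule.mem_span_singleton_self x⟩ : Submodule.span R {x}) = 0 := by
    rw [← Submodule.mem_bot R, ← hs]
    exact Submodule.smul_mem_smul hr Submodule.mem_top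
  simpa using congrArg Subtype.val h

end Nakayama

section FiniteLength

variable {R : Type*} [CommRing R] [IsNoetherianRing R] {M : Type*} [AddCommGroup M] [Module R M]

/-- R/Ann(M) is Noetherian of dimension zero, hence Artinian, and over an Artinian ring Artinian
modules are Noetherian. -/
theorem isFiniteLength_of_cosupp_subset [IsArtinian R M] (h : cosupp R M ⊆ maxSet R) :
    IsFiniteLength R M := by
  have : Ring.KrullDimLE 0 (R ⧸ Module.annihilator R M) := by
    refine .mk₀ fun I hI => ?_
    have hker : RingHom.ker (Ideal.Quotient.mk (Module.annihilator R M)) ≤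
        I.comap (Ideal.Quotient.mk (Module.annihilator R M)) := Ideal.comap_mono bot_le
    have hm : (I.comap (Ideal.Quotient.mk (Module.annihilator R M))).IsMaximal :=
      @h ⟨_, hI.comap (Ideal.Quotient.mk (Module.annihilator R M))⟩ (Ideal.mk_ker.ge.trans hker)
    have h2 := Ideal.IsMaximal.map_of_surjective_of_ker_le (m := I.comap
      (Ideal.Quotient.mk (Module.annihilator R M))) Ideal.Quotient.mk_surjective hker
    rwa [Ideal.map_comap_of_surjective _ Ideal.Quotient.mk_surjective] at h2
  have : IsArtinianRing (R ⧸ Module.annihilator R M) :=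
    IsNoetherianRing.isArtinianRing_of_krullDimLE_zero
  have ht : Module.IsTorsionBySet R M (Module.annihilator R M) :=
    Module.isTorsionBySet_annihilator R M
  let : Module (R ⧸ Module.annihilator R M) M := ht.module
  have : IsScalarTower R (R ⧸ Module.annihilator R M) M := ht.isScalarTower
  have : IsArtinian (R ⧸ Module.annihilator R M) M := isArtinian_of_tower R inferInstance
  have hn : IsNoetherian (R ⧸ Module.annihilator R M) M :=
    IsSemiprimaryRing.isNoetherian_iff_isArtinian.mpr this
  have : Module.Finite R M := Module.Finite.trans (R ⧸ Module.annihilator R M) M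
  exact isFiniteLength_iff_isNoetherian_isArtinian.mpr ⟨inferInstance, inferInstance⟩

end FiniteLength

/-! ### Injective hulls -/

section InjectiveHull

universe u

variable {R : Type u} [CommRing R]

theorem exists_injective_to_baer (A : Type u) [AddCommGroup A] [Module R A] :
    ∃ (I : Type u) (_ : AddCommGroup I) (_ : Module R I) (i : A →ₗ[R] I),
      Function.Injective i ∧ Module.Baer R I := by
  obtain ⟨P⟩ := CategoryTheory.EnoughInjectives.presentation (ModuleCat.of R A)
  refine ⟨P.J, inferInstance, inferInstance, P.f.hom,
    (ModuleCat.mono_iff_injective P.f).mp P.mono, ?_⟩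
  have : CategoryTheory.Injective (ModuleCat.of R P.J) := P.injective
  exact Module.Baer.of_injective (Module.injective_module_of_injective_object R P.J)

/-- Every module has an injective hull. -/
theorem exists_baer_essential (A : Type u) [AddCommGroup A] [Module R A] :
    ∃ (E : Type u) (_ : AddCommGroup E) (_ : Module R E) (i : A →ₗ[R] E),
      Function.Injective i ∧ Module.Baer R E ∧
        ∀ C : Submodule R E, C ⊓ LinearMap.range i = ⊥ → C = ⊥ := by
  obtain ⟨I, _, _, i, hi, hI⟩ := exists_injective_to_baer (R := R) A
  set A' := LinearMap.range i
  let ess : Set (Submodule R I) := {E | A' ≤ E ∧ ∀ C ≤ E, C ⊓ A' = ⊥ → C = ⊥}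
  -- E is a maximal essential extension of A' inside I. With C maximal subject to C ∩ E = 0, E
  -- embeds in I/C, and injectivity of I gives r : I → I fixing E and killing C.
  obtain ⟨E, hAE, hE⟩ : ∃ E, A' ≤ E ∧ Maximal (· ∈ ess) E := by
    refine zorn_le_nonempty₀ ess (fun c hc hch y hy => ⟨sSup c, ⟨?_, ?_⟩, fun z hz => le_sSup hz⟩)
      A' ⟨le_rfl, fun C hC h => by rwa [inf_eq_left.mpr hC] at h⟩
    · exact (hc hy).1.trans (le_sSup hy)
    · intro C hC h
      rw [eq_bot_iff]
      intro x hx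
      obtain ⟨D, hD, hxD⟩ := (Submodule.mem_sSup_of_directed ⟨y, hy⟩ hch.directedOn).mp (hC hx)
      have := (hc hD).2 (C ⊓ D) inf_le_right
        (eq_bot_iff.mpr ((inf_le_inf_right _ inf_le_left).trans h.le))
      exact this.le ⟨hx, hxD⟩
  obtain ⟨C, -, hC⟩ : ∃ C, ⊥ ≤ C ∧ Maximal (· ∈ {C : Submodule R I | C ⊓ E = ⊥}) C := by
    refine zorn_le_nonempty₀ _ (fun c hc hch y hy => ⟨sSup c, ?_, fun z hz => le_sSup hz⟩) ⊥
      (bot_inf_eq E)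
    refine eq_bot_iff.mpr ?_
    rintro x ⟨hx, hxE⟩
    obtain ⟨D, hD, hxD⟩ := (Submodule.mem_sSup_of_directed ⟨y, hy⟩ hch.directedOn).mp hx
    exact (hc hD).le ⟨hxD, hxE⟩
  have hCE : C ⊓ E = ⊥ := hC.prop
  obtain ⟨h, hh⟩ := hI.extension_property (C.mkQ ∘ₗ E.subtype) (by
    rw [← LinearMap.ker_eq_bot, LinearMap.ker_comp, Submodule.ker_mkQ, eq_bot_iff]
    intro x hx
    rw [Submodule.mem_bot, ← Submodule.coe_eq_zero, ← Submodule.mem_bot R, ← hCE]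
    exact ⟨hx, x.2⟩) E.subtype
  have hE' : ∀ x ∈ E, h (C.mkQ x) = x := fun x hx => LinearMap.congr_fun hh ⟨x, hx⟩
  have hmax : ∀ D : Submodule R I, C ≤ D → D ⊓ E = ⊥ → D = C := fun D hD h =>
    (hC.le_of_ge h hD).antisymm hD
  set r := h ∘ₗ C.mkQ with hr
  have hrange : LinearMap.range r = E := by
    have hle : E ≤ LinearMap.range r := fun x hx => ⟨x, hE' x hx⟩
    -- The image of r is still essential over A': if D in it misses A', then r⁻¹(D) misses E, so it
    -- equals C and D = 0. By maximality the image is E, a direct summand of I.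
    refine (hE.le_of_ge ⟨hAE.trans hle, fun D hD hDA => ?_⟩ hle).antisymm hle
    have h1 : D ⊓ E = ⊥ := hE.prop.2 _ inf_le_right
      (eq_bot_iff.mpr ((inf_le_inf_right _ inf_le_left).trans hDA.le))
    have h2 : D.comap r = C := by
      refine hmax _ ?_ ?_
      · intro x hx
        have : C.mkQ x = 0 := (Submodule.Quotient.mk_eq_zero C).mpr hx
        simp [hr, this]
      · rw [eq_bot_iff, ← h1]
        rintro x ⟨hx, hxE⟩
        refine ⟨?_, hxE⟩
        have : r x ∈ D := hx
        rwa [show r x = x from hE' x hxE] at this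
    rw [eq_bot_iff]
    intro x hx
    obtain ⟨z, rfl⟩ := hD hx
    have hz : z ∈ C := h2 ▸ (show z ∈ D.comap r from hx)
    have : C.mkQ z = 0 := (Submodule.Quotient.mk_eq_zero C).mpr hz
    simp [hr, this]
  let π : I →ₗ[R] E := r.codRestrict E fun x => hrange ▸ LinearMap.mem_range_self r x
  refine ⟨E, inferInstance, inferInstance, i.codRestrict E fun a => hAE ⟨a, rfl⟩, ?_, ?_, ?_⟩
  · exact fun a b hab => hi (congrArg Subtype.val hab)
  · intro J g
    obtain ⟨g', hg'⟩ := hI J (E.subtype ∘ₗ g)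
    refine ⟨π ∘ₗ g', fun x hx => Subtype.ext ?_⟩
    have : g' x = g ⟨x, hx⟩ := hg' x hx
    change r (g' x) = _
    rw [this]
    exact hE' _ (g ⟨x, hx⟩).2
  · intro D hD
    have : D.map E.subtype = ⊥ := by
      refine hE.prop.2 _ (Submodule.map_subtype_le E D) ?_
      rw [eq_bot_iff]
      rintro _ ⟨⟨x, hx, rfl⟩, ⟨a, ha⟩⟩
      have hx0 : x ∈ D ⊓ LinearMap.range (i.codRestrict E fun a => hAE ⟨a, rfl⟩) :=
        ⟨hx, a, Subtype.ext ha⟩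
      rw [hD, Submodule.mem_bot] at hx0
      simp [hx0]
    refine eq_bot_iff.mpr fun x hx => ?_
    have hx0 : (x : I) ∈ D.map E.subtype := ⟨x, hx, rfl⟩
    rw [this] at hx0
    exact Subtype.ext hx0

end InjectiveHull

/-! ### Duality into an injective module -/

section Dual

variable {R : Type*} [CommRing R] {E : Type*} [AddCommGroup E] [Module R E]
variable {K : Type*} [AddCommGroup K] [Module R K]

/-- For generators b of 𝔟, the map k ↦ (b k)_b has kernel (0 :_K 𝔟), so f factors through its image;
extending to the whole power of K writes f as ∑ b • h_b. -/
theorem mem_smul_top_of_eq_zero_on_torsionBySet (hE : Module.Baer R E) {𝔟 : Ideal R} (h𝔟 : 𝔟.FG)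
    (f : K →ₗ[R] E) (hf : ∀ k ∈ zeroColon K 𝔟, f k = 0) :
    f ∈ 𝔟 • (⊤ : Submodule R (K →ₗ[R] E)) := by
  classical
  obtain ⟨s, rfl⟩ := h𝔟
  let ψ : K →ₗ[R] (s → K) := LinearMap.pi fun b => (b : R) • LinearMap.id
  have hker : LinearMap.ker ψ ≤ LinearMap.ker f := by
    intro k hk
    refine hf k ?_
    rw [zeroColon, ← Submodule.torsionBySet_eq_torsionBySet_span]
    rw [Submodule.mem_torsionBySet_iff]
    rintro ⟨b, hb⟩
    exact congrFun (show ψ k = 0 from hk) ⟨b, hb⟩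
  obtain ⟨h, hh⟩ := hE.extension_property ((LinearMap.ker ψ).liftQ ψ le_rfl)
    (LinearMap.ker_eq_bot.mp (Submodule.ker_liftQ_eq_bot _ _ _ le_rfl))
    ((LinearMap.ker ψ).liftQ f hker)
  have key : f = ∑ b : s, (b : R) • (h ∘ₗ LinearMap.single R (fun _ => K) b) := by
    ext k
    have h1 : f k = h (ψ k) := (LinearMap.congr_fun hh ((LinearMap.ker ψ).mkQ k)).symm
    have h2 : ψ k = ∑ b : s, (b : R) • LinearMap.single R (fun _ => K) b k := by
      ext c
      simp [ψ, Finset.sum_apply, Pi.single_apply]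
    rw [h1, h2]
    simp
  rw [key]
  exact Submodule.sum_mem _ fun b _ =>
    Submodule.smul_mem_smul (Ideal.subset_span b.2) Submodule.mem_top

theorem apply_eq_zero_of_mem_smul_top {𝔟 : Ideal R} {f : K →ₗ[R] E}
    (hf : f ∈ 𝔟 • (⊤ : Submodule R (K →ₗ[R] E))) {k : K} (hk : ∀ r ∈ 𝔟, r • k = 0) : f k = 0 := by
  induction hf using Submodule.smul_induction_on' with
  | smul r hr g _ => rw [LinearMap.smul_apply, ← map_smul, hk r hr, map_zero]
  | add g _ g' _ h h' => rw [LinearMap.add_apply, h, h', add_zero]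

/-- Rq surjects onto some R/m, which maps to E without killing 1; extend from Rq to K. -/
theorem exists_apply_ne_zero_of_baer (hE : Module.Baer R E)
    (hs : ∀ m : Ideal R, m.IsMaximal → ∃ e : E, e ≠ 0 ∧ ∀ r ∈ m, r • e = 0)
    {q : K} (hq : q ≠ 0) : ∃ f : K →ₗ[R] E, f q ≠ 0 := by
  set φ := LinearMap.toSpanSingleton R K q
  obtain ⟨m, hm, hle⟩ := Ideal.exists_le_maximal (LinearMap.ker φ) fun h => hq <| by
    have : (1 : R) ∈ LinearMap.ker φ := h ▸ Submodule.mem_top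
    simpa [φ] using this
  obtain ⟨e, he, hme⟩ := hs m hm
  obtain ⟨h, hh⟩ := hE.extension_property ((LinearMap.ker φ).liftQ φ le_rfl)
    (LinearMap.ker_eq_bot.mp (Submodule.ker_liftQ_eq_bot _ _ _ le_rfl))
    ((LinearMap.ker φ).liftQ (LinearMap.toSpanSingleton R E e) fun r hr => hme r (hle hr))
  refine ⟨h, ?_⟩
  have h1 : h (φ 1) = LinearMap.toSpanSingleton R E e 1 :=
    LinearMap.congr_fun hh ((LinearMap.ker φ).mkQ 1)
  simp only [φ, LinearMap.toSpanSingleton_apply, one_smul] at h1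
  rwa [h1]

theorem mem_annihilator_of_forall_smul_eq_zero (hE : Module.Baer R E)
    (hs : ∀ m : Ideal R, m.IsMaximal → ∃ e : E, e ≠ 0 ∧ ∀ r ∈ m, r • e = 0)
    {r : R} (hr : ∀ f : K →ₗ[R] E, r • f = 0) : r ∈ Module.annihilator R K := by
  rw [Module.mem_annihilator]
  intro k
  by_contra hk
  obtain ⟨f, hf⟩ := exists_apply_ne_zero_of_baer hE hs hk
  exact hf (by rw [map_smul]; exact LinearMap.congr_fun (hr f) k)

end Dual

/-! ### Semi-local rings and completeness -/

section Semilocal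

variable {R : Type*} [CommRing R]

theorem isMaximal_of_jacobson_le [Finite (MaximalSpectrum R)] {p : Ideal R} [hp : p.IsPrime]
    (h : Ring.jacobson R ≤ p) : p.IsMaximal := by
  have := Fintype.ofFinite (MaximalSpectrum R)
  have h1 : Finset.univ.inf (fun m : MaximalSpectrum R => m.asIdeal) ≤ p := by
    refine le_trans ?_ h
    rw [← Ideal.jacobson_bot]
    refine le_sInf ?_
    rintro m ⟨-, hm⟩
    exact Finset.inf_le (f := fun m : MaximalSpectrum R => m.asIdeal) (Finset.mem_univ ⟨m, hm⟩)
  obtain ⟨m, -, hm⟩ := hp.inf_le'.mp h1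
  rw [← m.isMaximal.eq_of_le hp.ne_top hm]
  exact m.isMaximal

theorem isSemisimpleRing_quotient_jacobson [IsNoetherianRing R] [Finite (MaximalSpectrum R)] :
    IsSemisimpleRing (R ⧸ Ring.jacobson R) := by
  have : Ring.KrullDimLE 0 (R ⧸ Ring.jacobson R) := by
    refine .mk₀ fun I hI => ?_
    have hker : RingHom.ker (Ideal.Quotient.mk (Ring.jacobson R)) ≤
        I.comap (Ideal.Quotient.mk (Ring.jacobson R)) := Ideal.comap_mono bot_le
    have := isMaximal_of_jacobson_le (Ideal.mk_ker.ge.trans hker)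
    have h2 := Ideal.IsMaximal.map_of_surjective_of_ker_le (m := I.comap
      (Ideal.Quotient.mk (Ring.jacobson R))) Ideal.Quotient.mk_surjective hker
    rwa [Ideal.map_comap_of_surjective _ Ideal.Quotient.mk_surjective] at h2
  have : IsArtinianRing (R ⧸ Ring.jacobson R) :=
    IsNoetherianRing.isArtinianRing_of_krullDimLE_zero
  exact IsArtinianRing.isSemisimpleRing_iff_jacobson.mpr (Ring.jacobson_quotient_jacobson R)

theorem isPrecomplete_pi {ι M : Type*} [Finite ι] [AddCommGroup M] [Module R M] (I : Ideal R)
    [IsPrecomplete I M] : IsPrecomplete I (ι → M) := by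
  classical
  have := Fintype.ofFinite ι
  have hproj : ∀ (n : ℕ) (x : ι → M) (i : ι), x ∈ (I ^ n • ⊤ : Submodule R (ι → M)) →
      x i ∈ (I ^ n • ⊤ : Submodule R M) := by
    intro n x i hx
    have : LinearMap.proj (R := R) (φ := fun _ : ι => M) i x ∈
        (I ^ n • ⊤ : Submodule R (ι → M)).map (LinearMap.proj i) := ⟨x, hx, rfl⟩
    rw [Submodule.map_smul''] at this
    exact Submodule.smul_mono le_rfl le_top this
  have hsingle : ∀ (n : ℕ) (x : ι → M), (∀ i, x i ∈ (I ^ n • ⊤ : Submodule R M)) →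
      x ∈ (I ^ n • ⊤ : Submodule R (ι → M)) := by
    intro n x hx
    rw [← Finset.univ_sum_single x]
    refine Submodule.sum_mem _ fun i _ => ?_
    have : LinearMap.single R (fun _ : ι => M) i (x i) ∈
        (I ^ n • ⊤ : Submodule R M).map (LinearMap.single R (fun _ : ι => M) i) := ⟨_, hx i, rfl⟩
    rw [Submodule.map_smul''] at this
    exact Submodule.smul_mono le_rfl le_top this
  refine ⟨fun f hf => ?_⟩
  have h : ∀ i, ∃ L : M, ∀ n, f n i ≡ L [SMOD (I ^ n • ⊤ : Submodule R M)] := fun i =>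
    IsPrecomplete.prec' (I := I) (fun n => f n i) fun {m n} hmn => by
      rw [SModEq.sub_mem]
      exact hproj m (f m - f n) i (SModEq.sub_mem.mp (hf hmn))
  choose L hL using h
  refine ⟨L, fun n => SModEq.sub_mem.mpr (hsingle n _ fun i => ?_)⟩
  exact SModEq.sub_mem.mp (hL i n)

/-- Over an `I`-adically complete ring, an `I`-adically separated module which is finite
modulo `I` is finite. -/
theorem finite_of_isHausdorff_of_finite_quotient {M : Type*} [AddCommGroup M] [Module R M]
    (I : Ideal R) [IsPrecomplete I R] [IsHausdorff I M]
    [Module.Finite R (M ⧸ (I • ⊤ : Submodule R M))] : Module.Finite R M := by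
  obtain ⟨n, g, hg⟩ := Module.Finite.exists_fin' R (M ⧸ (I • ⊤ : Submodule R M))
  obtain ⟨f, hf⟩ := Module.projective_lifting_property (I • ⊤ : Submodule R M).mkQ g
    (Submodule.mkQ_surjective _)
  have := isPrecomplete_pi (ι := Fin n) (M := R) I
  exact Module.Finite.of_surjective f (surjective_of_mkQ_comp_surjective (I := I) (hf ▸ hg))

end Semilocal

/-! ### Finiteness of the dual -/

section DualFinite

universe u

variable {R : Type u} [CommRing R]

theorem isSemisimpleModule_of_jacobson_smul_eq_zero [IsNoetherianRing R] [Finite (MaximalSpectrum R)]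
    {T : Type*} [AddCommGroup T] [Module R T]
    (h : ∀ r ∈ Ring.jacobson R, ∀ x : T, r • x = 0) : IsSemisimpleModule R T := by
  have ht : Module.IsTorsionBySet R T (Ring.jacobson R) := fun x r => h r r.2 x
  have := isSemisimpleRing_quotient_jacobson (R := R)
  let : Module (R ⧸ Ring.jacobson R) T := ht.module
  exact ht.isSemisimpleModule_iff.mp inferInstance

/-- The image of T in E is semisimple, and a complement in it of its part inside the image of A must
vanish by essentiality. So every map lands in that image, which is finite, as is T. -/
theorem finite_linearMap_of_essential [IsNoetherianRing R] [Finite (MaximalSpectrum R)]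
    {T : Type*} [AddCommGroup T] [Module R T] [IsArtinian R T]
    (hT : ∀ r ∈ Ring.jacobson R, ∀ x : T, r • x = 0)
    {A E : Type*} [AddCommGroup A] [Module R A] [Module.Finite R A] [AddCommGroup E] [Module R E]
    (i : A →ₗ[R] E) (hi : ∀ C : Submodule R E, C ⊓ LinearMap.range i = ⊥ → C = ⊥) :
    IsNoetherian R (T →ₗ[R] E) := by
  have := isSemisimpleModule_of_jacobson_smul_eq_zero hT
  have hTfin : Module.Finite R T := (IsSemisimpleModule.finite_tfae.out 2 0).mp ‹IsArtinian R T›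
  have hrange : ∀ f : T →ₗ[R] E, LinearMap.range f ≤ LinearMap.range i := by
    intro f
    have : IsSemisimpleModule R (LinearMap.range f) := .range f
    obtain ⟨C, hC⟩ := exists_isCompl ((LinearMap.range i).comap (LinearMap.range f).subtype)
    have hC0 : C.map (LinearMap.range f).subtype = ⊥ := by
      refine hi _ (eq_bot_iff.mpr ?_)
      rintro _ ⟨⟨x, hx, rfl⟩, hxi⟩
      have : x ∈ ((LinearMap.range i).comap (LinearMap.range f).subtype) ⊓ C := ⟨hxi, hx⟩
      rw [hC.inf_eq_bot, Submodule.mem_bot] at this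
      simp [this]
    have hCbot : C = ⊥ := by
      refine eq_bot_iff.mpr fun x hx => ?_
      have hx0 : (x : E) ∈ C.map (LinearMap.range f).subtype := ⟨x, hx, rfl⟩
      rw [hC0] at hx0
      exact Subtype.ext hx0
    have htop := hC.sup_eq_top
    rw [hCbot, sup_bot_eq] at htop
    intro x hx
    have : (⟨x, hx⟩ : LinearMap.range f) ∈
      (LinearMap.range i).comap (LinearMap.range f).subtype := htop ▸ Submodule.mem_top
    exact this
  refine isNoetherian_of_surjective
    (LinearMap.compRight R (M := T) (LinearMap.range i).subtype)
    (LinearMap.range_eq_top.mpr fun f => ?_)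
  exact ⟨f.codRestrict _ fun x => hrange f ⟨x, rfl⟩, rfl⟩

/-- The dual is J-adically separated because each element of K is killed by a power of J. Modulo J
it embeds in the dual of (0 :_K J), which is Noetherian; completeness then lifts generators. -/
theorem finite_dual_of_isArtinian [IsNoetherianRing R] [Finite (MaximalSpectrum R)]
    [IsAdicComplete (Ring.jacobson R) R]
    {K : Type*} [AddCommGroup K] [Module R K] [IsArtinian R K]
    {A E : Type*} [AddCommGroup A] [Module R A] [Module.Finite R A] [AddCommGroup E] [Module R E]
    (hE : Module.Baer R E) (i : A →ₗ[R] E)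
    (hi : ∀ C : Submodule R E, C ⊓ LinearMap.range i = ⊥ → C = ⊥) :
    Module.Finite R (K →ₗ[R] E) := by
  set J := Ring.jacobson R
  have : IsHausdorff J (K →ₗ[R] E) := by
    refine ⟨fun f hf => LinearMap.ext fun k => ?_⟩
    obtain ⟨s, hs⟩ := exists_jacobson_pow_smul_eq_zero (R := R) k
    exact apply_eq_zero_of_mem_smul_top (SModEq.zero.mp (hf s)) hs
  have : IsNoetherian R (zeroColon K J →ₗ[R] E) :=
    finite_linearMap_of_essential (fun r hr x => Subtype.ext (mem_zeroColon_iff.mp x.2 r hr)) i hi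
  let ρ : (K →ₗ[R] E) →ₗ[R] (zeroColon K J →ₗ[R] E) := LinearMap.lcomp R E (zeroColon K J).subtype
  have hρ : LinearMap.ker ρ = J • ⊤ := by
    refine le_antisymm (fun f hf => ?_) fun f hf => ?_
    · exact mem_smul_top_of_eq_zero_on_torsionBySet hE (IsNoetherian.noetherian _) f
        fun k hk => LinearMap.congr_fun (show ρ f = 0 from hf) ⟨k, hk⟩
    · refine LinearMap.ext fun k => ?_
      exact apply_eq_zero_of_mem_smul_top hf (mem_zeroColon_iff.mp k.2)
  have : IsNoetherian R ((K →ₗ[R] E) ⧸ (J • ⊤ : Submodule R (K →ₗ[R] E))) :=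
    isNoetherian_of_injective ((J • ⊤ : Submodule R (K →ₗ[R] E)).liftQ ρ hρ.ge)
      (LinearMap.ker_eq_bot.mp (Submodule.ker_liftQ_eq_bot _ _ _ hρ.le))
  exact finite_of_isHausdorff_of_finite_quotient J

variable (R) in
/-- An injective cogenerator, essential over a finite module. -/
theorem exists_baer_cogenerator [Finite (MaximalSpectrum R)] :
    ∃ (A E : Type u) (_ : AddCommGroup A) (_ : Module R A) (_ : AddCommGroup E) (_ : Module R E)
      (i : A →ₗ[R] E), Module.Finite R A ∧ Module.Baer R E ∧
        (∀ C : Submodule R E, C ⊓ LinearMap.range i = ⊥ → C = ⊥) ∧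
        ∀ m : Ideal R, m.IsMaximal → ∃ e : E, e ≠ 0 ∧ ∀ r ∈ m, r • e = 0 := by
  classical
  obtain ⟨E, _, _, i, hi, hE, hess⟩ :=
    exists_baer_essential (R := R) ((m : MaximalSpectrum R) → R ⧸ m.asIdeal)
  refine ⟨_, E, _, _, _, _, i, inferInstance, hE, hess, fun m hm => ?_⟩
  refine ⟨i (Pi.single ⟨m, hm⟩ 1), fun h => ?_, fun r hr => ?_⟩
  · have h0 := hi (h.trans (map_zero i).symm)
    have : Nontrivial (R ⧸ m) := Ideal.Quotient.nontrivial_iff.mpr hm.ne_top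
    exact one_ne_zero (α := R ⧸ m) (by simp at h0)
  · rw [← map_smul, ← Pi.single_smul]
    have : r • (1 : R ⧸ m) = 0 := by
      rw [Algebra.smul_def, mul_one]
      exact Ideal.Quotient.eq_zero_iff_mem.mpr hr
    rw [this, Pi.single_zero, map_zero]

end DualFinite

/-! ### Choosing the next element -/

section Extension

variable {R : Type*} [CommRing R]

/-- Cayley–Hamilton: a monic polynomial with lower coefficients in 𝔞 sends z into Ann(M) ≤ q, so a
power of z lies in q. -/
theorem mem_of_isPrime_of_smul_mem {M : Type*} [AddCommGroup M] [Module R M]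
    [Module.Finite R M] {q 𝔞 : Ideal R} [hq : q.IsPrime] (hann : Module.annihilator R M ≤ q)
    (h𝔞 : 𝔞 ≤ q) {z : R} (hz : ∀ f : M, z • f ∈ 𝔞 • (⊤ : Submodule R M)) : z ∈ q := by
  obtain ⟨p, hp, -, hcoeff, haeval⟩ :=
    LinearMap.exists_monic_and_natDegree_eq_and_coeff_mem_pow_and_aeval_eq_zero R
      (algebraMap R (Module.End R M) z) 𝔞 (by rintro _ ⟨f, rfl⟩; exact hz f)
  have h1 : p.eval z ∈ q := by
    refine hann (Module.mem_annihilator.mpr fun f => ?_)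
    rw [Polynomial.aeval_algebraMap_apply] at haeval
    exact LinearMap.congr_fun haeval f
  rw [Polynomial.eval_eq_sum_range, Finset.sum_range_succ, hp.coeff_natDegree, one_mul] at h1
  refine hq.mem_of_pow_mem p.natDegree ((Ideal.add_mem_iff_right _ ?_).mp h1)
  refine Ideal.sum_mem _ fun k hk => q.mul_mem_right _ (h𝔞 ?_)
  exact Ideal.pow_le_self (Nat.sub_ne_zero_of_lt (Finset.mem_range.mp hk)) (hcoeff k)

theorem exists_mem_forall_associatedPrimes_isMaximal [IsNoetherianRing R]
    {M : Type*} [AddCommGroup M] [Module R M] [Module.Finite R M] {𝔞 : Ideal R}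
    (h : ∀ q ∈ associatedPrimes R M, 𝔞 ≤ q → q.IsMaximal) :
    ∃ y ∈ 𝔞, ∀ q ∈ associatedPrimes R M, y ∈ q → q.IsMaximal := by
  have hfin : {q ∈ associatedPrimes R M | ¬ q.IsMaximal}.Finite :=
    (associatedPrimes.finite R M).subset (Set.sep_subset _ _)
  by_contra! H
  have hsub : (𝔞 : Set R) ⊆ ⋃ q ∈ (hfin.toFinset : Set (Ideal R)), (q : Set R) := by
    intro y hy
    obtain ⟨q, hq, hyq, hmax⟩ := H y hy
    exact Set.mem_biUnion (by simpa using ⟨hq, hmax⟩) hyq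
  -- The two ⊥ are the indices at which prime avoidance tolerates nonprime ideals; every ideal here
  -- is prime, so they are arbitrary.
  obtain ⟨q, hq, hle⟩ := (Ideal.subset_union_prime (f := id) ⊥ ⊥ fun q hq _ _ =>
    ((hfin.mem_toFinset.mp hq).1).1).mp hsub
  have hq' := hfin.mem_toFinset.mp hq
  exact hq'.2 (h q hq'.1 hle)

theorem exists_mem_cosupp_quotSMulTop_subset [IsNoetherianRing R] [Finite (MaximalSpectrum R)]
    [IsAdicComplete (Ring.jacobson R) R] {K : Type*} [AddCommGroup K] [Module R K] [IsArtinian R K]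
    {𝔞 : Ideal R} (h : IsFiniteLength R (zeroColon K 𝔞)) :
    ∃ y ∈ 𝔞, cosupp R (QuotSMulTop y K) ⊆ maxSet R := by
  obtain ⟨A, E, _, _, _, _, i, _, hE, hess, hsimple⟩ := exists_baer_cogenerator R
  have := finite_dual_of_isArtinian (K := K) hE i hess
  obtain ⟨_, _⟩ := isFiniteLength_iff_isNoetherian_isArtinian.mp h
  obtain ⟨s, hs⟩ := exists_jacobson_pow_smul_top_eq_bot (R := R) (M := zeroColon K 𝔞)
  obtain ⟨y, hy, hass⟩ := exists_mem_forall_associatedPrimes_isMaximal (M := K →ₗ[R] E) (𝔞 := 𝔞) <| by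
    intro q hq h𝔞
    have : q.IsPrime := hq.1
    refine isMaximal_of_jacobson_le fun z hz => this.mem_of_pow_mem s ?_
    refine mem_of_isPrime_of_smul_mem (M := K →ₗ[R] E) 
      (Submodule.annihilator_top.ge.trans hq.annihilator_le) h𝔞
      fun f => ?_
    refine mem_smul_top_of_eq_zero_on_torsionBySet hE (IsNoetherian.noetherian _) _ fun k hk => ?_
    have hk0 : z ^ s • (⟨k, hk⟩ : zeroColon K 𝔞) = 0 := by
      rw [← Submodule.mem_bot R, ← hs]
      exact Submodule.smul_mem_smul (Ideal.pow_mem_pow hz s) Submodule.mem_top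
    rw [LinearMap.smul_apply, ← map_smul,
      show z ^ s • k = 0 from congrArg Subtype.val hk0, map_zero]
  refine ⟨y, hy, fun p hp => ?_⟩
  -- M' plays the dual of K/yK. Since E is a cogenerator, whatever kills M' kills K/yK.
  let M' := Submodule.torsionBy R (K →ₗ[R] E) y
  have hle : Module.annihilator R M' ≤ p.asIdeal := by
    refine le_trans (fun r hr => ?_) hp
    refine mem_annihilator_of_forall_smul_eq_zero hE hsimple fun f => ?_
    have hf : f ∘ₗ Submodule.mkQ _ ∈ M' := by
      rw [Submodule.mem_torsionBy_iff]
      ext k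
      rw [LinearMap.smul_apply, LinearMap.comp_apply, ← map_smul, ← map_smul]
      have : (y • (⊤ : Submodule R K)).mkQ (y • k) = 0 :=
        (Submodule.Quotient.mk_eq_zero _).mpr
          (Submodule.smul_mem_pointwise_smul _ _ _ Submodule.mem_top)
      rw [this, map_zero, LinearMap.zero_apply]
    have h0 := congrArg Subtype.val (Module.mem_annihilator.mp hr ⟨_, hf⟩)
    refine LinearMap.ext fun x => ?_
    obtain ⟨k, rfl⟩ := Submodule.mkQ_surjective _ x
    exact LinearMap.congr_fun h0 k
  -- A minimal prime over Ann(M') is associated to M', hence to the dual of K, and contains y; so it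
  -- is maximal and equals p.
  obtain ⟨q, hq, hqp⟩ := Ideal.exists_minimalPrimes_le hle
  have hqass := Module.associatedPrimes.minimalPrimes_annihilator_subset_associatedPrimes R M' hq
  have hyq : y ∈ q := by
    refine Submodule.annihilator_top.ge.trans hqass.annihilator_le
      (Module.mem_annihilator.mpr fun f => ?_)
    exact Subtype.ext ((Submodule.mem_torsionBy_iff _ _).mp f.2)
  have hmax := hass q (hqass.map_of_injective M'.subtype M'.injective_subtype) hyq
  change p.asIdeal.IsMaximal
  rwa [← hmax.eq_of_le p.isPrime.ne_top hqp]

end Extension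

/-! ### Extending sequences, and infinite sequences -/

section FilterCoregularSequences

variable {R : Type*} [CommRing R] {N : Type*} [AddCommGroup N] [Module R N]

theorem cosupp_eq_of_linearEquiv {M M' : Type*} [AddCommGroup M] [Module R M]
    [AddCommGroup M'] [Module R M'] (e : M ≃ₗ[R] M') : cosupp R M = cosupp R M' := by
  simp only [cosupp, e.annihilator_eq]

theorem cosupp_quotSMulTop_subset_congr {s t : Set R} (hst : s = t) {y z : R} (hyz : y = z)
    (h : cosupp R (QuotSMulTop y (zeroColon N (Ideal.span s))) ⊆ maxSet R) :
    cosupp R (QuotSMulTop z (zeroColon N (Ideal.span t))) ⊆ maxSet R := by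
  subst hst hyz
  exact h

theorem exists_isFilterCoregularIn_snoc [IsNoetherianRing R] [IsArtinian R N]
    [Finite (MaximalSpectrum R)] [IsAdicComplete (Ring.jacobson R) R] {𝔞 : Ideal R}
    (h : IsFiniteLength R (zeroColon N 𝔞)) {n : ℕ} {x : Fin n → R}
    (hx : IsFilterCoregularIn N 𝔞 x) :
    ∃ y : R, IsFilterCoregularIn N 𝔞 (Fin.snoc x y : Fin (n + 1) → R) := by
  let K := zeroColon N (Ideal.span (Set.range x))
  have hK : IsFiniteLength R (zeroColon K 𝔞) := by
    obtain ⟨_, _⟩ := isFiniteLength_iff_isNoetherian_isArtinian.mp h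
    let g : zeroColon K 𝔞 →ₗ[R] zeroColon N 𝔞 :=
      (K.subtype ∘ₗ (zeroColon K 𝔞).subtype).codRestrict _ fun k =>
        mem_zeroColon_iff.mpr fun r hr => congrArg Subtype.val (mem_zeroColon_iff.mp k.2 r hr)
    have hg : Function.Injective g := fun a b hab =>
      Subtype.ext (Subtype.ext (congrArg (Subtype.val : zeroColon N 𝔞 → N) hab))
    exact isFiniteLength_iff_isNoetherian_isArtinian.mpr
      ⟨isNoetherian_of_injective g hg, isArtinian_of_injective g hg⟩
  obtain ⟨y, hy, hmax⟩ := exists_mem_cosupp_quotSMulTop_subset hK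
  refine ⟨y, fun i => ?_, fun i => ?_⟩
  · refine Fin.lastCases ?_ (fun j => ?_) i
    · simpa using hy
    · simpa using hx.1 j
  · refine Fin.lastCases ?_ (fun j => ?_) i
    · have himg : (Fin.snoc x y : Fin (n + 1) → R) '' {j | j < Fin.last n} = Set.range x := by
        ext r
        constructor
        · rintro ⟨j, hj, rfl⟩
          obtain ⟨k, rfl⟩ := Fin.eq_castSucc_of_ne_last (ne_of_lt hj)
          exact ⟨k, by simp⟩
        · rintro ⟨k, rfl⟩
          exact ⟨k.castSucc, Fin.castSucc_lt_last k, by simp⟩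
      exact cosupp_quotSMulTop_subset_congr himg.symm (Fin.snoc_last (α := fun _ => R) y x).symm hmax
    · have himg : (Fin.snoc x y : Fin (n + 1) → R) '' {k | k < j.castSucc} = x '' {k | k < j} := by
        ext r
        constructor
        · rintro ⟨k, hk, rfl⟩
          obtain ⟨k, rfl⟩ := Fin.eq_castSucc_of_ne_last (hk.trans (Fin.castSucc_lt_last j)).ne
          exact ⟨k, Fin.castSucc_lt_castSucc_iff.mp hk, by simp⟩
        · rintro ⟨k, hk, rfl⟩
          exact ⟨k.castSucc, Fin.castSucc_lt_castSucc_iff.mpr hk, by simp⟩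
      exact cosupp_quotSMulTop_subset_congr himg.symm
        (Fin.snoc_castSucc (α := fun _ => R) y x j).symm (hx.2 j)

theorem isFiniteLength_zeroColon_of_infinite [IsNoetherianRing R] [IsArtinian R N] {𝔞 : Ideal R}
    {x : ℕ → R} (hx : IsInfiniteFilterCoregularIn N 𝔞 x) : IsFiniteLength R (zeroColon N 𝔞) := by
  let K : ℕ → Submodule R N := fun n => zeroColon N (Ideal.span (x '' {j | j < n}))
  obtain ⟨n, hn⟩ := IsArtinian.monotone_stabilizes (R := R) (M := N)
    ⟨fun n => OrderDual.toDual (K n), fun a b hab => Submodule.torsionBySet_le_torsionBySet_of_subset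
      (Ideal.span_mono (Set.image_mono fun j hj => lt_of_lt_of_le hj hab))⟩
  have hK : K n = K (n + 1) := hn (n + 1) (Nat.le_succ n)
  have hzero : x n • (⊤ : Submodule R (K n)) = ⊥ := by
    rw [eq_bot_iff]
    rintro _ ⟨k, -, rfl⟩
    have hk : (k : N) ∈ K (n + 1) := hK ▸ k.2
    exact Subtype.ext (mem_zeroColon_iff.mp hk (x n)
      (Ideal.subset_span ⟨n, Nat.lt_succ_self n, rfl⟩))
  have himg : (fun i : Fin (n + 1) => x i) '' {j | j < Fin.last n} = x '' {j | j < n} := by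
    ext r
    constructor
    · rintro ⟨j, hj, rfl⟩
      exact ⟨j, hj, rfl⟩
    · rintro ⟨j, hj, rfl⟩
      exact ⟨⟨j, Nat.lt_succ_of_lt hj⟩, hj, rfl⟩
  have hcos : cosupp R (QuotSMulTop (x n) (K n)) ⊆ maxSet R :=
    cosupp_quotSMulTop_subset_congr himg rfl ((hx (n + 1)).2 (Fin.last n))
  rw [cosupp_eq_of_linearEquiv (Submodule.quotEquivOfEqBot _ hzero)] at hcos
  obtain ⟨_, _⟩ := isFiniteLength_iff_isNoetherian_isArtinian.mp
    (isFiniteLength_of_cosupp_subset hcos)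
  have hle : zeroColon N 𝔞 ≤ K n := by
    refine Submodule.torsionBySet_le_torsionBySet_of_subset (Ideal.span_le.mpr ?_)
    rintro _ ⟨j, -, rfl⟩
    exact (hx (j + 1)).1 (Fin.last j)
  exact isFiniteLength_iff_isNoetherian_isArtinian.mpr
    ⟨isNoetherian_of_injective _ (Submodule.inclusion_injective hle),
      isArtinian_of_injective _ (Submodule.inclusion_injective hle)⟩

end FilterCoregularSequences

theorem proposition2p12 {R : Type*} [CommRing R] [Nontrivial R] [IsNoetherianRing R]
    (𝔞 : Ideal R) (N : Type*) [AddCommGroup N] [Module R N] [IsArtinian R N] :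
    (FilterCoregular.fWidth N 𝔞 = ⊤ →
      IsFiniteLength R (FilterCoregular.zeroColon N 𝔞)) ∧
    (Finite (MaximalSpectrum R) → IsAdicComplete (Ring.jacobson R) R →
      IsFiniteLength R (FilterCoregular.zeroColon N 𝔞) →
      FilterCoregular.fWidth N 𝔞 = ⊤) := by
  refine ⟨fun h => ?_, fun _ _ h => ?_⟩
  · obtain ⟨x, hx⟩ := (fWidth_eq_top_iff N 𝔞).mp h
    exact isFiniteLength_zeroColon_of_infinite hx
  · rw [fWidth_eq_top_iff]
    by_contra hinf
    obtain ⟨n, x, hx⟩ := exists_isMaximalFilterCoregularIn N 𝔞 hinf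
    obtain ⟨y, hy⟩ := exists_isFilterCoregularIn_snoc h hx.1
    exact hx.2 y hy
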